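/- Let $D$ be an integral domain with quotient field $K$. Call an ideal of $D$ an MNI ideal if it is maximal (under inclusion) among the non-invertible ideals of $D$ (the zero ideal counts as non-invertible). $D$ is called an MPD (multiplicatively pinched-Dedekind) domain if it has a unique MNI ideal $Q$ and every nonzero non-invertible ideal of $D$ can be written as $JQ$ for some invertible ideal $J$ of $D$. Let $\mathcal{O}(D)$ be the set of all overrings of $D$, i.e. of all subrings $E$ with $D \subseteq E \subseteq K$, and let $\mathcal{O}_{ql}(D)$ be the set of those overrings that are quasi-local, i.e. have exactly one maximal ideal. Let $D$ be an MPD domain that is not a field and has exactly $n < \infty$ maximal ideals. Then (a) $|\mathcal{O}(D)| = 2^n$ or $|\mathcal{O}(D)| = 3\cdot 2^{n-1}$; (b) $|\mathcal{O}_{ql}(D)| = n+2$ or $|\mathcal{O}_{ql}(D)| = n+1$. -/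

import Mathlib

open scoped nonZeroDivisors

/-- An (integral) ideal of a domain is invertible when it is a unit in the monoid of
fractional ideals. In particular the zero ideal is not invertible and `D` itself is. -/
def IsInvertibleIdeal {D : Type*} [CommRing D] [IsDomain D] (I : Ideal D) : Prop :=
  IsUnit (I : FractionalIdeal D⁰ (FractionRing D))

/-- An MNI ideal: an ideal that is maximal, under inclusion, among the non-invertible ideals
of `D` (the zero ideal being allowed). -/
def IsMNIIdeal {D : Type*} [CommRing D] [IsDomain D] (Q : Ideal D) : Prop :=
  Maximal (fun I : Ideal D => ¬ IsInvertibleIdeal I) Q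

/-- A multiplicatively pinched-Dedekind (MPD) domain: `D` has a unique MNI ideal `Q`, and every
nonzero non-invertible ideal of `D` is a product `J * Q` with `J` an invertible ideal of `D`. -/
def IsMPDDomain (D : Type*) [CommRing D] [IsDomain D] : Prop :=
  ∃ Q : Ideal D, IsMNIIdeal Q ∧ (∀ Q' : Ideal D, IsMNIIdeal Q' → Q' = Q) ∧
    ∀ I : Ideal D, I ≠ ⊥ → ¬ IsInvertibleIdeal I →
      ∃ J : Ideal D, IsInvertibleIdeal J ∧ I = J * Q

/-- The overrings of a domain `D` with quotient field `K`: the subrings of `K` containing `D`,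
that is, the `D`-subalgebras of `K`. -/
abbrev Overring (D K : Type*) [CommRing D] [Field K] [Algebra D K] : Type _ :=
  Subalgebra D K

/-- The quasi-local overrings: those with exactly one maximal ideal (no chain condition). -/
abbrev QuasiLocalOverring (D K : Type*) [CommRing D] [Field K] [Algebra D K] : Type _ :=
  {E : Overring D K // IsLocalRing E}

/-! With finitely many maximal ideals, invertible ideals are principal. So the hypothesis gives a
prime Q such that every ideal strictly above Q is principal and every nonzero ideal is (x) or xQ. If
Q ≠ 0, only one maximal ideal contains Q (`maximal_eq_of_le_of_le`). The property `PrincipalUpTo`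
passes to localizations. Where M does not contain Q, or if Q = 0, D_M is a local PID, and its only
overrings are itself and K.

At the remaining maximal ideal the local ring has two or three overrings, all quasi-local
(`PrincipalUpTo.card_subalgebra`). If it is a valuation ring, an overring is determined by its
centre, which is 0, Q or 𝔪. Otherwise Q = 𝔪 has two generators, 𝔪² = x𝔪 for some x, and x⁻¹𝔪 is a
valuation ring through which every overring is controlled: nothing else lies between the ring and K.

Distinct D_M and D_N generate K, so an overring of D is a free choice of one overring of each D_M
(`equivPi`), and the counts multiply. A quasi-local overring other than K contains exactly one D_M,
so those counts, each less one for K, add up, and K itself contributes one more. -/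

/-- Every nonzero ideal is principal or a principal multiple of `Q`. -/
def PrincipalUpTo {R : Type*} [CommRing R] (Q : Ideal R) : Prop :=
  ∀ I : Ideal R, I ≠ ⊥ → ∃ x, I = Ideal.span {x} ∨ I = Ideal.span {x} * Q

/-! ### Semilocal MPD domains: principal ideals and the prime Q -/

lemma isInvertibleIdeal_iff_of_finite {D : Type*} [CommRing D] [IsDomain D]
    [Finite (MaximalSpectrum D)] (I : Ideal D) :
    IsInvertibleIdeal I ↔ ∃ x, x ≠ 0 ∧ I = Ideal.span {x} := by
  constructor
  · intro h
    have hf : {I : Ideal D | I.IsMaximal}.Finite :=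
      (Set.finite_range (MaximalSpectrum.asIdeal (R := D))).subset
        fun M hM => ⟨⟨M, hM⟩, rfl⟩
    obtain ⟨x, hx⟩ := Ideal.IsPrincipal.of_finite_maximals_of_isUnit hf h
    refine ⟨x, ?_, hx⟩
    rintro rfl
    have : I = ⊥ := by rw [hx]; simp
    subst this
    simp [IsInvertibleIdeal] at h
  · rintro ⟨x, hx, rfl⟩
    rw [IsInvertibleIdeal, FractionalIdeal.coeIdeal_span_singleton]
    have hx' : algebraMap D (FractionRing D) x ≠ 0 := by simpa using hx
    refine IsUnit.of_mul_eq_one (FractionalIdeal.spanSingleton D⁰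
      (algebraMap D (FractionRing D) x)⁻¹) ?_
    rw [FractionalIdeal.spanSingleton_mul_spanSingleton, mul_inv_cancel₀ hx',
      FractionalIdeal.spanSingleton_one]

/-- If ab ∈ Q with a, b ∉ Q, then Q + (a) = (x), and the colon ideal (Q : x) contains Q and b, so it
is some (y). As Q ⊆ (x), this gives Q = (yx), a contradiction. -/
lemma isPrime_of_maximal_not_principal {D : Type*} [CommRing D] [IsDomain D] {Q : Ideal D}
    (hQ : ¬ ∃ x, x ≠ 0 ∧ Q = Ideal.span {x})
    (hmax : ∀ I, Q < I → ∃ x, x ≠ 0 ∧ I = Ideal.span {x}) : Q.IsPrime := by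
  refine ⟨fun h => hQ ⟨1, one_ne_zero, by simp [h]⟩, fun {a b} hab => ?_⟩
  by_contra! h
  obtain ⟨ha, hb⟩ := h
  have haQ : Q < Q ⊔ Ideal.span {a} :=
    left_lt_sup.2 fun h => ha (h (Ideal.mem_span_singleton_self a))
  obtain ⟨x, hx, hxI⟩ := hmax _ haQ
  have hQx : ∀ q ∈ Q, x ∣ q := fun q hq =>
    Ideal.mem_span_singleton.1 (hxI ▸ Ideal.mem_sup_left hq)
  have hbx : b * x ∈ Q := by
    have : x ∈ Q ⊔ Ideal.span {a} := hxI ▸ Ideal.mem_span_singleton_self x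
    obtain ⟨q, hq, y, hy, rfl⟩ := Submodule.mem_sup.1 this
    obtain ⟨c, rfl⟩ := Ideal.mem_span_singleton.1 hy
    have : b * (q + a * c) = b * q + c * (a * b) := by ring
    rw [this]
    exact add_mem (Ideal.mul_mem_left _ _ hq) (Ideal.mul_mem_left _ _ hab)
  let P : Ideal D := Submodule.comap (LinearMap.mulRight D x) Q
  have hP : ∀ d, d ∈ P ↔ d * x ∈ Q := fun d => Iff.rfl
  have hQP : Q < P :=
    lt_of_le_of_ne (fun q hq => (hP q).2 (Ideal.mul_mem_right _ _ hq))
      fun h => hb (h ▸ (hP b).2 hbx)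
  obtain ⟨y, hy, hyP⟩ := hmax _ hQP
  refine hQ ⟨y * x, mul_ne_zero hy hx, le_antisymm (fun q hq => ?_) ?_⟩
  · obtain ⟨c, rfl⟩ := hQx q hq
    have : c ∈ P := (hP c).2 (by rwa [mul_comm])
    rw [hyP] at this
    obtain ⟨e, rfl⟩ := Ideal.mem_span_singleton.1 this
    exact Ideal.mem_span_singleton.2 ⟨e, by ring⟩
  · rw [Ideal.span_singleton_le_iff_mem, ← hP, hyP]
    exact Ideal.mem_span_singleton_self y

lemma eq_mul_of_mem_of_lt_span {D : Type*} [CommRing D] {Q : Ideal D} [hQ : Q.IsPrime] {p : D}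
    (h : Q < Ideal.span {p}) {q : D} (hq : q ∈ Q) : ∃ q' ∈ Q, q = p * q' := by
  obtain ⟨c, rfl⟩ := Ideal.mem_span_singleton.1 (h.le hq)
  refine ⟨c, (hQ.mem_or_mem hq).resolve_left fun hp => ?_, rfl⟩
  exact h.not_ge ((Ideal.span_singleton_le_iff_mem _).2 hp)

/-- Two such maximal ideals would be (p) and (r), with Q = pQ = rQ. For 0 ≠ x ∈ Q, the ideal I = D ∩
xD[1/p] satisfies I = pI, so it is not principal and I = yQ. Then I = rI as well, so x ∈ rI, which
makes r divide a power of p. -/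
lemma maximal_eq_of_le_of_le {D : Type*} [CommRing D] [IsDomain D] {Q : Ideal D}
    [hQ : Q.IsPrime] (hQ0 : Q ≠ ⊥) (hup : PrincipalUpTo Q)
    (hmax : ∀ I, Q < I → ∃ x, x ≠ 0 ∧ I = Ideal.span {x})
    {M N : Ideal D} (hM : M.IsMaximal) (hN : N.IsMaximal) (hQM : Q ≤ M) (hQN : Q ≤ N) :
    M = N := by
  by_contra hne
  have hQM' : Q < M := lt_of_le_of_ne hQM fun h => hne (hM.eq_of_le hN.ne_top (h ▸ hQN))
  have hQN' : Q < N := lt_of_le_of_ne hQN fun h => hne (hN.eq_of_le hM.ne_top (h ▸ hQM)).symm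
  obtain ⟨p, hp, rfl⟩ := hmax M hQM'
  obtain ⟨r, hr, rfl⟩ := hmax N hQN'
  obtain ⟨x, hxQ, hx⟩ := Submodule.exists_mem_ne_zero_of_ne_bot hQ0
  have hpQ : p ∉ Q := fun h => hQM'.not_ge ((Ideal.span_singleton_le_iff_mem _).2 h)
  let I : Ideal D :=
    { carrier := {d | ∃ m : ℕ, x ∣ p ^ m * d}
      zero_mem' := ⟨0, by simp⟩
      add_mem' := by
        rintro a b ⟨m, hm⟩ ⟨k, hk⟩
        refine ⟨m + k, ?_⟩
        have : p ^ (m + k) * (a + b) = p ^ k * (p ^ m * a) + p ^ m * (p ^ k * b) := by ring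
        rw [this]
        exact dvd_add (hm.mul_left _) (hk.mul_left _)
      smul_mem' := by
        rintro c a ⟨m, hm⟩
        refine ⟨m, ?_⟩
        have : p ^ m * (c • a) = c * (p ^ m * a) := by simp only [smul_eq_mul]; ring
        rw [this]
        exact hm.mul_left _ }
  have hI : ∀ d, d ∈ I ↔ ∃ m : ℕ, x ∣ p ^ m * d := fun d => Iff.rfl
  have hxI : x ∈ I := (hI x).2 ⟨0, by simp⟩
  have hdiv : ∀ d ∈ I, ∃ d' ∈ I, d = p * d' := by
    intro d hd
    obtain ⟨m, hm⟩ := (hI d).1 hd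
    have h1 : p ^ m * d ∈ Q := Q.mem_of_dvd hm hxQ
    have hdQ : d ∈ Q := (hQ.mem_or_mem h1).resolve_left fun h => hpQ (hQ.mem_of_pow_mem _ h)
    obtain ⟨d', -, rfl⟩ := eq_mul_of_mem_of_lt_span hQM' hdQ
    exact ⟨d', (hI d').2 ⟨m + 1, by rwa [pow_succ, mul_assoc]⟩, rfl⟩
  have hI0 : I ≠ ⊥ := fun h => hx (by simpa [h] using hxI)
  obtain ⟨y, hy | hy⟩ := hup I hI0
  · have hyI : y ∈ I := hy ▸ Ideal.mem_span_singleton_self y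
    obtain ⟨d, hd, hyd⟩ := hdiv y hyI
    rw [hy] at hd
    obtain ⟨c, rfl⟩ := Ideal.mem_span_singleton.1 hd
    have hy0 : y ≠ 0 := by
      rintro rfl
      exact hI0 (by rw [hy]; simp)
    refine hM.ne_top ((Ideal.span_singleton_eq_top).2 (IsUnit.of_mul_eq_one c ?_))
    apply mul_left_cancel₀ hy0
    linear_combination -hyd
  · rw [hy] at hxI
    obtain ⟨q, hq, hxq⟩ := Ideal.mem_span_singleton_mul.1 hxI
    obtain ⟨q', hq', rfl⟩ := eq_mul_of_mem_of_lt_span hQN' hq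
    have : y * q' ∈ I := by rw [hy]; exact Ideal.mem_span_singleton_mul.2 ⟨q', hq', rfl⟩
    obtain ⟨m, e, hm⟩ := (hI _).1 this
    have key : p ^ m = r * e := by
      apply mul_left_cancel₀ hx
      linear_combination p ^ m * (-hxq) + r * hm
    have hpN : p ∈ Ideal.span {r} :=
      hN.isPrime.mem_of_pow_mem m (Ideal.mem_span_singleton.2 ⟨e, key⟩)
    exact hne (hM.eq_of_le hN.ne_top ((Ideal.span_singleton_le_iff_mem _).2 hpN))

lemma IsMPDDomain.exists_prime {D : Type*} [CommRing D] [IsDomain D]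
    [Finite (MaximalSpectrum D)] (hD : IsMPDDomain D) :
    ∃ Q : Ideal D, Q.IsPrime ∧ PrincipalUpTo Q ∧
      ∀ I, Q < I → ∃ x, x ≠ 0 ∧ I = Ideal.span {x} := by
  obtain ⟨Q, hQ, -, hJ⟩ := hD
  have hmax : ∀ I, Q < I → ∃ x, x ≠ 0 ∧ I = Ideal.span {x} := by
    intro I hI
    rw [← isInvertibleIdeal_iff_of_finite]
    by_contra h
    exact hI.not_ge (hQ.2 h hI.le)
  refine ⟨Q, isPrime_of_maximal_not_principal
    (by rw [← isInvertibleIdeal_iff_of_finite]; exact hQ.1) hmax, fun I hI => ?_, hmax⟩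
  by_cases h : IsInvertibleIdeal I
  · obtain ⟨x, -, hx⟩ := (isInvertibleIdeal_iff_of_finite I).1 h
    exact ⟨x, Or.inl hx⟩
  · obtain ⟨J, hJ, rfl⟩ := hJ I hI h
    obtain ⟨x, -, rfl⟩ := (isInvertibleIdeal_iff_of_finite J).1 hJ
    exact ⟨x, Or.inr rfl⟩

/-! ### Valuation rings, centres of overrings, and powers of an element of Q -/

section Local

open IsLocalRing

/-- If P = (x), an element q outside P divides x, and primeness puts the cofactor in (x), so q is a
unit. If P = xQ, primeness gives x ∈ P, which is impossible, or Q ≤ P. -/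
lemma ValuationRing.eq_or_eq_of_isPrime {R : Type*} [CommRing R] [IsDomain R] [ValuationRing R]
    {Q : Ideal R} [hQ : Q.IsPrime] (hup : PrincipalUpTo Q) {P : Ideal R} (hP : P.IsPrime)
    (hP0 : P ≠ ⊥) : P = maximalIdeal R ∨ P = Q := by
  obtain ⟨x, hx | hx⟩ := hup P hP0
  · left
    have hx0 : x ≠ 0 := by rintro rfl; exact hP0 (by simpa using hx)
    refine le_antisymm (le_maximalIdeal hP.ne_top) fun q hq => ?_
    by_contra hqP
    have hxq : ¬ x ∣ q := by rwa [hx, Ideal.mem_span_singleton] at hqP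
    obtain ⟨r, hr⟩ := (ValuationRing.dvd_total x q).resolve_left hxq
    have hxP : q * r ∈ P := by rw [hx, ← hr]; exact Ideal.mem_span_singleton_self x
    have h := (hP.mem_or_mem hxP).resolve_left hqP
    rw [hx, Ideal.mem_span_singleton] at h
    obtain ⟨c, rfl⟩ := h
    have : q * c = 1 := mul_left_cancel₀ hx0 (by linear_combination -hr)
    exact (mem_maximalIdeal _).1 hq (IsUnit.of_mul_eq_one _ this)
  · right
    have hx0 : x ≠ 0 := by rintro rfl; exact hP0 (by simpa using hx)
    refine le_antisymm (hx.le.trans Ideal.mul_le_right) ?_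
    rcases hP.mul_le.1 hx.ge with h | h
    · have hxP : x ∈ Ideal.span {x} * Q := hx ▸ h (Ideal.mem_span_singleton_self x)
      obtain ⟨q, hq, hxq⟩ := Ideal.mem_span_singleton_mul.1 hxP
      have : q = 1 := mul_left_cancel₀ hx0 (by rw [hxq, mul_one])
      exact absurd (Q.eq_top_iff_one.2 (this ▸ hq)) hQ.ne_top
    · exact h

/-- The centre on a valuation ring of an overring. -/
def ValuationRing.centre {R K : Type*} [CommRing R] [IsDomain R] [ValuationRing R] [Field K]
    [Algebra R K] [IsFractionRing R K] (E : Subalgebra R K) : Ideal R where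
  carrier := {r | r = 0 ∨ (algebraMap R K r)⁻¹ ∉ E}
  zero_mem' := Or.inl rfl
  add_mem' := by
    -- Divisibility is total, so one summand divides the other and only sums r + rt need treatment.
    have key : ∀ r t : R, (r = 0 ∨ (algebraMap R K r)⁻¹ ∉ E) →
        (r + r * t = 0 ∨ (algebraMap R K (r + r * t))⁻¹ ∉ E) := by
      rintro r t (rfl | hr)
      · left; simp
      · by_contra! h
        obtain ⟨h0, h⟩ := h
        refine hr ?_
        have h0' : algebraMap R K (r + r * t) ≠ 0 :=
          (map_ne_zero_iff _ (IsFractionRing.injective R K)).2 h0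
        have hr0 : algebraMap R K r ≠ 0 := by
          intro h
          have : r = 0 := by simpa using h
          exact h0 (by simp [this])
        have : (algebraMap R K r)⁻¹ =
            algebraMap R K (1 + t) * (algebraMap R K (r + r * t))⁻¹ := by
          rw [eq_mul_inv_iff_mul_eq₀ h0', inv_mul_eq_iff_eq_mul₀ hr0]
          simp only [map_add, map_mul, map_one]; ring
        rw [this]
        exact mul_mem (E.algebraMap_mem _) h
    intro a b ha hb
    rcases ValuationRing.dvd_total a b with ⟨t, rfl⟩ | ⟨t, rfl⟩
    · exact key _ _ ha
    · rw [add_comm]; exact key _ _ hb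
  smul_mem' := by
    rintro c r (rfl | hr)
    · left; simp
    · by_cases hc : c = 0
      · left; simp [hc]
      right
      intro h
      refine hr ?_
      have hc0 : algebraMap R K c ≠ 0 := by simpa using hc
      have : (algebraMap R K r)⁻¹ = algebraMap R K c * (algebraMap R K (c • r))⁻¹ := by
        rw [smul_eq_mul, map_mul, mul_inv, mul_inv_cancel_left₀ hc0]
      rw [this]
      exact mul_mem (E.algebraMap_mem _) h

namespace ValuationRing

variable {R K : Type*} [CommRing R] [IsDomain R] [ValuationRing R] [Field K]
    [Algebra R K] [IsFractionRing R K]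

lemma mem_centre {E : Subalgebra R K} {r : R} :
    r ∈ centre E ↔ r = 0 ∨ (algebraMap R K r)⁻¹ ∉ E := Iff.rfl

instance centre_isPrime (E : Subalgebra R K) : (centre E).IsPrime := by
  refine ⟨fun h => ?_, fun {a b} hab => ?_⟩
  · have : (1 : R) ∈ centre E := h ▸ Submodule.mem_top
    rcases mem_centre.1 this with h | h
    · exact one_ne_zero h
    · exact h (by simp)
  · simp only [mem_centre] at hab ⊢
    by_contra! h
    rcases hab with h' | h'
    · rcases mul_eq_zero.1 h' with h' | h'
      exacts [h.1.1 h', h.2.1 h']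
    · rw [map_mul, mul_inv] at h'
      exact h' (mul_mem h.1.2 h.2.2)

/-- Each element of K lies in R or is the inverse of an element of R, so an overring is known once
the invertible elements of R in it are. -/
lemma centre_injective : Function.Injective (centre : Subalgebra R K → Ideal R) := by
  have key : ∀ E F : Subalgebra R K, centre E = centre F → E ≤ F := by
    intro E F h k hk
    rcases isInteger_or_isInteger R k with ⟨r, hr⟩ | ⟨r, hr⟩
    · rw [← hr]; exact F.algebraMap_mem r
    · by_cases hr0 : r = 0
      · have : k = 0 := by simpa [hr0] using hr.symm
        rw [this]; exact F.zero_mem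
      · have hk' : k = (algebraMap R K r)⁻¹ := by rw [hr, inv_inv]
        have : r ∉ centre E := by
          rw [mem_centre]; push Not; exact ⟨hr0, hk' ▸ hk⟩
        rw [h, mem_centre] at this
        push Not at this
        rw [hk']; exact this.2
  exact fun E F h => le_antisymm (key _ _ h) (key _ _ h.symm)

-- The bound is left as the size of a `Finset` so that coincidences count: it drops to 2 when Q = ⊥.
open Classical in
lemma card_subalgebra_le {Q : Ideal R} [Q.IsPrime] (hup : PrincipalUpTo Q) :
    Finite (Subalgebra R K) ∧
      Nat.card (Subalgebra R K) ≤ ({⊥, maximalIdeal R, Q} : Finset (Ideal R)).card := by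
  let f : Subalgebra R K → ({⊥, maximalIdeal R, Q} : Finset (Ideal R)) := fun E =>
    ⟨centre E, by
      simp only [Finset.mem_insert, Finset.mem_singleton]
      by_cases h : centre E = ⊥
      · exact Or.inl h
      · exact Or.inr (eq_or_eq_of_isPrime hup inferInstance h)⟩
  have hf : Function.Injective f := fun E F h => centre_injective (Subtype.ext_iff.1 h)
  refine ⟨Finite.of_injective f hf, ?_⟩
  exact (Nat.card_le_card_of_injective f hf).trans_eq (Nat.card_eq_finsetCard _)

end ValuationRing

lemma isLocalRing_of_mem_or_inv_mem {R K : Type*} [CommRing R] [Field K] [Algebra R K]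
    (E : Subalgebra R K) (h : ∀ k : K, k ∈ E ∨ k⁻¹ ∈ E) : IsLocalRing E := by
  refine .of_isUnit_or_isUnit_one_sub_self fun a => ?_
  have unit : ∀ b : E, (b : K) ≠ 0 → (b : K)⁻¹ ∈ E → IsUnit b := fun b hb hb' =>
    IsUnit.of_mul_eq_one ⟨_, hb'⟩ (Subtype.ext (mul_inv_cancel₀ hb))
  by_cases h0 : (a : K) = 0
  · right
    have : a = 0 := Subtype.ext h0
    simp [this]
  by_cases h1 : (1 - a : K) = 0
  · left
    have : a = 1 := Subtype.ext (sub_eq_zero.1 h1).symm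
    simp [this]
  -- Adding 1 to a/(1-a) gives (1-a)⁻¹, and adding 1 to its inverse gives a⁻¹.
  rcases h (a / (1 - a)) with h | h
  · right
    refine unit (1 - a) h1 ?_
    have : ((1 - a : E) : K)⁻¹ = a / (1 - a) + 1 := by
      push_cast
      field_simp
      ring
    rw [this]
    exact add_mem h E.one_mem
  · left
    refine unit a h0 ?_
    have : (a : K)⁻¹ = (a / (1 - a) : K)⁻¹ + 1 := by
      field_simp
      ring
    rw [this]
    exact add_mem h E.one_mem

/-- The intersection J of the (qⁿ) satisfies J = qJ. If J ≠ 0, then J = (y) makes q a unit, and J =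
yQ puts 1 in Q. -/
lemma PrincipalUpTo.exists_not_pow_dvd {R : Type*} [CommRing R] [IsDomain R] {Q : Ideal R}
    (hup : PrincipalUpTo Q) (hQ : Q ≠ ⊤) {q : R} (hq : q ∈ Q) (hq0 : q ≠ 0) {d : R} (hd : d ≠ 0) :
    ∃ n : ℕ, ¬ q ^ n ∣ d := by
  by_contra! h
  let J : Ideal R := ⨅ n : ℕ, Ideal.span {q ^ n}
  have hJ : ∀ c, c ∈ J ↔ ∀ n, q ^ n ∣ c := fun c => by
    simp [J, Submodule.mem_iInf, Ideal.mem_span_singleton]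
  have hdJ : d ∈ J := (hJ d).2 h
  have hJ0 : J ≠ ⊥ := fun h => hd (by simpa [h] using hdJ)
  have hdiv : ∀ c ∈ J, ∃ c' ∈ J, c = q * c' := by
    intro c hc
    obtain ⟨c', rfl⟩ : q ∣ c := by simpa using (hJ c).1 hc 1
    refine ⟨c', (hJ c').2 fun n => ?_, rfl⟩
    have := (hJ _).1 hc (n + 1)
    rw [pow_succ'] at this
    exact (mul_dvd_mul_iff_left hq0).1 this
  obtain ⟨y, hy | hy⟩ := hup J hJ0
  · have hy0 : y ≠ 0 := by rintro rfl; exact hJ0 (by rw [hy]; simp)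
    obtain ⟨c, hc, hyc⟩ := hdiv y (hy ▸ Ideal.mem_span_singleton_self y)
    rw [hy] at hc
    obtain ⟨r, rfl⟩ := Ideal.mem_span_singleton.1 hc
    have : q * r = 1 := mul_left_cancel₀ hy0 (by linear_combination -hyc)
    exact hQ (Q.eq_top_of_isUnit_mem hq (IsUnit.of_mul_eq_one _ this))
  · have hy0 : y ≠ 0 := by rintro rfl; exact hJ0 (by rw [hy]; simp)
    obtain ⟨c, hc, hyc⟩ := hdiv (y * q) (hy ▸ Ideal.mem_span_singleton_mul.2 ⟨q, hq, rfl⟩)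
    rw [hy] at hc
    obtain ⟨t, ht, rfl⟩ := Ideal.mem_span_singleton_mul.1 hc
    have : t = 1 := mul_left_cancel₀ (mul_ne_zero hy0 hq0) (by linear_combination -hyc)
    exact hQ (Q.eq_top_iff_one.2 (this ▸ ht))

end Local

/-! ### Local rings that are not Bézout: the overring S = x⁻¹𝔪 -/

section NonBezout

open IsLocalRing

lemma Ideal.eq_span_singleton_of_span_singleton_mul_eq {R : Type*} [CommRing R] [IsDomain R]
    {I : Ideal R} {z w : R} (hz : z ≠ 0) (h : Ideal.span {z} * I = Ideal.span {w}) :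
    ∃ c, I = Ideal.span {c} := by
  have hw : w ∈ Ideal.span {z} * I := h ▸ Ideal.mem_span_singleton_self w
  obtain ⟨c, -, rfl⟩ := Ideal.mem_span_singleton_mul.1 hw
  rw [← Ideal.span_singleton_mul_span_singleton] at h
  exact ⟨c, (Ideal.span_singleton_mul_right_inj hz).1 h⟩

/-- A non-principal (u, v) has the form yQ; dividing by y exhibits two generators of Q. -/
lemma exists_eq_span_pair_of_not_isBezout {R : Type*} [CommRing R] [IsDomain R] {Q : Ideal R} (hup : PrincipalUpTo Q)
    (h : ¬ IsBezout R) : ∃ a b, Q = Ideal.span {a, b} ∧ ∀ y, Q ≠ Ideal.span {y} := by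
  rw [IsBezout.iff_span_pair_isPrincipal] at h
  push Not at h
  obtain ⟨u, v, h⟩ := h
  have hnp : ∀ w, Ideal.span {u, v} ≠ Ideal.span {w} := fun w hw => h ⟨w, hw⟩
  obtain ⟨y, hy⟩ := hup (Ideal.span {u, v}) (fun h => hnp 0 (by simpa using h))
  replace hy := hy.resolve_left (hnp y)
  have hy0 : y ≠ 0 := by rintro rfl; exact hnp 0 (by rw [hy]; simp)
  have hu : u ∈ Ideal.span {y} * Q := hy ▸ Ideal.subset_span (by simp)
  have hv : v ∈ Ideal.span {y} * Q := hy ▸ Ideal.subset_span (by simp)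
  obtain ⟨a, -, rfl⟩ := Ideal.mem_span_singleton_mul.1 hu
  obtain ⟨b, -, rfl⟩ := Ideal.mem_span_singleton_mul.1 hv
  refine ⟨a, b, ?_, fun c hc => ?_⟩
  · apply (Ideal.span_singleton_mul_right_inj hy0).1
    rw [← hy, Ideal.span_mul_span']
    simp [Set.image_pair]
  · rw [hc, Ideal.span_singleton_mul_span_singleton] at hy
    exact hnp _ hy

variable {R : Type*} [CommRing R] [IsLocalRing R]

/-- If Q < 𝔪, then 𝔪 is not of the form pQ, so 𝔪 = (p) and Q = pQ. Nakayama then gives Q = 0, which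
is principal. -/
lemma eq_maximalIdeal_of_fg {Q : Ideal R} [hQ : Q.IsPrime] (hup : PrincipalUpTo Q) (hfg : Q.FG)
    (hnp : ∀ y, Q ≠ Ideal.span {y}) : Q = maximalIdeal R := by
  by_contra hne
  have hlt : Q < maximalIdeal R := lt_of_le_of_ne (le_maximalIdeal hQ.ne_top) hne
  obtain ⟨p, hp | hp⟩ := hup (maximalIdeal R) (ne_bot_of_gt hlt)
  · refine hnp 0 ?_
    have : Q = ⊥ := by
      refine Submodule.eq_bot_of_le_smul_of_le_jacobson_bot (Ideal.span {p}) Q hfg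
        (fun q hq => ?_) (hp ▸ maximalIdeal_le_jacobson _)
      obtain ⟨q', hq', rfl⟩ := eq_mul_of_mem_of_lt_span (hp ▸ hlt) hq
      exact Ideal.mem_span_singleton_mul.2 ⟨q', hq', rfl⟩
    rw [this]; simp
  · exact hlt.not_ge (hp.le.trans Ideal.mul_le_right)

variable {K : Type*} [Field K] [Algebra R K] {x : R}

/-- The overring `x⁻¹ 𝔪`, when the maximal ideal satisfies `𝔪² = x 𝔪`. -/
def divOverring (K : Type*) [Field K] [Algebra R K] [IsFractionRing R K]
    (hxm : x ∈ maximalIdeal R) (hx0 : x ≠ 0)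
    (hmm : maximalIdeal R * maximalIdeal R = Ideal.span {x} * maximalIdeal R) :
    Subalgebra R K where
  carrier := {k | ∃ q ∈ maximalIdeal R, algebraMap R K x * k = algebraMap R K q}
  add_mem' := by
    rintro k l ⟨q, hq, hk⟩ ⟨r, hr, hl⟩
    exact ⟨q + r, add_mem hq hr, by rw [mul_add, hk, hl, map_add]⟩
  mul_mem' := by
    rintro k l ⟨q, hq, hk⟩ ⟨r, hr, hl⟩
    have : q * r ∈ Ideal.span {x} * maximalIdeal R := hmm ▸ Ideal.mul_mem_mul hq hr
    obtain ⟨t, ht, htx⟩ := Ideal.mem_span_singleton_mul.1 this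
    have hx' : algebraMap R K x ≠ 0 := (map_ne_zero_iff _ (IsFractionRing.injective R K)).2 hx0
    refine ⟨t, ht, mul_left_cancel₀ hx' ?_⟩
    rw [← map_mul, htx, map_mul, ← hk, ← hl]
    ring
  algebraMap_mem' r :=
    ⟨x * r, Ideal.mul_mem_right _ _ hxm, by rw [map_mul]⟩

variable [IsFractionRing R K] {hxm : x ∈ maximalIdeal R} {hx0 : x ≠ 0}
  {hmm : maximalIdeal R * maximalIdeal R = Ideal.span {x} * maximalIdeal R}

lemma mem_divOverring {k : K} : k ∈ divOverring K hxm hx0 hmm ↔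
    ∃ q ∈ maximalIdeal R, algebraMap R K x * k = algebraMap R K q := Iff.rfl

lemma exists_algebraMap_eq_mul {q : R} (hq : q ∈ maximalIdeal R) {s : K}
    (hs : s ∈ divOverring K hxm hx0 hmm) :
    ∃ t ∈ maximalIdeal R, algebraMap R K q * s = algebraMap R K t := by
  obtain ⟨r, hr, hs⟩ := hs
  have : q * r ∈ Ideal.span {x} * maximalIdeal R := hmm ▸ Ideal.mul_mem_mul hq hr
  obtain ⟨t, ht, htx⟩ := Ideal.mem_span_singleton_mul.1 this
  have hx' : algebraMap R K x ≠ 0 := (map_ne_zero_iff _ (IsFractionRing.injective R K)).2 hx0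
  refine ⟨t, ht, mul_left_cancel₀ hx' ?_⟩
  rw [← map_mul, htx, map_mul, ← hs]
  ring

/-- Since r₁ is a unit, 𝔪 = (x, b) and S = R + R(b/x). Writing e = c + d(b/x), the coefficient d is
a unit, for otherwise db ∈ 𝔪² = x𝔪 and e ∈ R. Hence b/x ∈ E. -/
lemma divOverring_le_of_isUnit {a b r₁ r₂ : R} (hab : maximalIdeal R = Ideal.span {a, b})
    (hr₁ : IsUnit r₁) (hx : r₁ * a + r₂ * b = x) {E : Subalgebra R K} {e : K} (heE : e ∈ E)
    (he : e ∈ divOverring K hxm hx0 hmm) (heR : e ∉ (⊥ : Subalgebra R K)) :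
    divOverring K hxm hx0 hmm ≤ E := by
  have hinj := IsFractionRing.injective R K
  have hx' : algebraMap R K x ≠ 0 := (map_ne_zero_iff _ hinj).2 hx0
  have hbm : b ∈ maximalIdeal R := hab ▸ Ideal.subset_span (by simp)
  obtain ⟨u, hu⟩ := hr₁.exists_right_inv
  have key : ∀ s ∈ divOverring K hxm hx0 hmm, ∃ c d, algebraMap R K x * s =
      algebraMap R K x * algebraMap R K c + algebraMap R K d * algebraMap R K b := by
    intro s hs
    obtain ⟨q, hq, hsq⟩ := mem_divOverring.1 hs
    rw [hab] at hq
    obtain ⟨f, g, rfl⟩ := Ideal.mem_span_pair.1 hq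
    refine ⟨f * u, g - f * u * r₂, ?_⟩
    rw [hsq, ← map_mul, ← map_mul, ← map_add]
    apply congrArg (algebraMap R K)
    linear_combination -f * a * hu + f * u * hx
  obtain ⟨c, d, hcd⟩ := key e he
  have hdu : IsUnit d := by
    by_contra hd
    have : d * b ∈ Ideal.span {x} * maximalIdeal R := hmm ▸ Ideal.mul_mem_mul hd hbm
    obtain ⟨t, -, ht⟩ := Ideal.mem_span_singleton_mul.1 this
    refine heR (Algebra.mem_bot.2 ⟨c + t, mul_left_cancel₀ hx' ?_⟩)
    rw [hcd, ← map_mul _ d b, ← ht, map_mul, map_add, mul_add]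
  obtain ⟨v, hv⟩ := hdu.exists_right_inv
  have hv' : algebraMap R K d * algebraMap R K v = 1 := by rw [← map_mul, hv, map_one]
  intro s hs
  obtain ⟨f, g, hfg⟩ := key s hs
  have : s = algebraMap R K f + algebraMap R K (g * v) * (e - algebraMap R K c) := by
    apply mul_left_cancel₀ hx'
    rw [map_mul]
    linear_combination hfg - algebraMap R K g * algebraMap R K v * hcd -
      algebraMap R K g * algebraMap R K b * hv'
  rw [this]
  exact add_mem (E.algebraMap_mem _) (mul_mem (E.algebraMap_mem _)
    (sub_mem heE (E.algebraMap_mem _)))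

variable [IsDomain R]

lemma exists_maximalIdeal_mul_self_eq (hup : PrincipalUpTo (maximalIdeal R))
    (hfg : (maximalIdeal R).FG) (hnp : ∀ y, maximalIdeal R ≠ Ideal.span {y}) :
    ∃ x ∈ maximalIdeal R, x ≠ 0 ∧
      maximalIdeal R * maximalIdeal R = Ideal.span {x} * maximalIdeal R := by
  have hm0 : maximalIdeal R ≠ ⊥ := fun h => hnp 0 (by rw [h]; simp)
  have hmm : maximalIdeal R * maximalIdeal R ≠ ⊥ := by simpa using hm0
  obtain ⟨x, hx | hx⟩ := hup _ hmm
  · exfalso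
    have hx0 : x ≠ 0 := by rintro rfl; exact hmm (by rw [hx]; simp)
    -- If 𝔪² = (x), a product rs equal to a unit times x would make r generate 𝔪. So all products
    -- lie in x𝔪, and x ∈ x𝔪 is absurd.
    have hle : ¬ maximalIdeal R * maximalIdeal R ≤ Ideal.span {x} * maximalIdeal R := by
      intro hle
      have := hle (hx ▸ Ideal.mem_span_singleton_self x)
      obtain ⟨t, ht, hxt⟩ := Ideal.mem_span_singleton_mul.1 this
      have : t = 1 := mul_left_cancel₀ hx0 (by rw [hxt, mul_one])
      exact (mem_maximalIdeal _).1 ht (this ▸ isUnit_one)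
    refine hle (Ideal.mul_le.2 fun r hr s hs => ?_)
    have hrs : r * s ∈ Ideal.span {x} := hx ▸ Ideal.mul_mem_mul hr hs
    obtain ⟨c, hc⟩ := Ideal.mem_span_singleton.1 hrs
    refine Ideal.mem_span_singleton_mul.2 ⟨c, (mem_maximalIdeal _).2 fun hcu => ?_, hc.symm⟩
    obtain ⟨c', hcc'⟩ := hcu.exists_right_inv
    refine hnp r (le_antisymm (fun q hq => ?_) ((Ideal.span_singleton_le_iff_mem _).2 hr))
    have hqs : q * s ∈ Ideal.span {x} := hx ▸ Ideal.mul_mem_mul hq hs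
    obtain ⟨d, hd⟩ := Ideal.mem_span_singleton.1 hqs
    have hs0 : s ≠ 0 := by
      rintro rfl
      have : c = 0 := (mul_eq_zero.1 (by simpa using hc.symm)).resolve_left hx0
      exact not_isUnit_zero (this ▸ hcu)
    refine Ideal.mem_span_singleton.2 ⟨c' * d, mul_right_cancel₀ hs0 ?_⟩
    linear_combination hd - c' * d * hc - x * d * hcc'
  · refine ⟨x, ?_, ?_, hx⟩
    · by_contra hxu
      have hxu : IsUnit x := by simpa using hxu
      rw [Ideal.span_singleton_eq_top.2 hxu, Ideal.top_mul] at hx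
      exact hm0 (Submodule.eq_bot_of_le_smul_of_le_jacobson_bot (maximalIdeal R) _ hfg hx.ge
        (maximalIdeal_le_jacobson _))
    · rintro rfl; exact hmm (by rw [hx]; simp)

lemma exists_span_singleton_mul_maximalIdeal_eq {x : R} (hxm : x ∈ maximalIdeal R)
    (hmm : maximalIdeal R * maximalIdeal R = Ideal.span {x} * maximalIdeal R)
    (hup : PrincipalUpTo (maximalIdeal R))
    (hnp : ∀ y, maximalIdeal R ≠ Ideal.span {y}) {z : R} (hz : z ∈ maximalIdeal R) (hz0 : z ≠ 0) :
    ∃ y, Ideal.span {z} * maximalIdeal R = Ideal.span {x * y} * maximalIdeal R := by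
  -- Because z𝔪 ⊆ 𝔪² = x𝔪, the ideal I is exactly x⁻¹z𝔪; it is not principal, so it is y𝔪.
  let I : Ideal R := Submodule.comap (LinearMap.mulLeft R x) (Ideal.span {z} * maximalIdeal R)
  have hmem : ∀ r, r ∈ I ↔ x * r ∈ Ideal.span {z} * maximalIdeal R := fun r => Iff.rfl
  have hI : Ideal.span {x} * I = Ideal.span {z} * maximalIdeal R := by
    refine le_antisymm ?_ fun r hr => ?_
    · intro r hr
      obtain ⟨t, ht, rfl⟩ := Ideal.mem_span_singleton_mul.1 hr
      exact ht
    · have hr' : r ∈ Ideal.span {x} * maximalIdeal R := by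
        rw [← hmm]
        exact Ideal.mul_mono_left ((Ideal.span_singleton_le_iff_mem _).2 hz) hr
      obtain ⟨t, ht, rfl⟩ := Ideal.mem_span_singleton_mul.1 hr'
      exact Ideal.mem_span_singleton_mul.2 ⟨t, hr, rfl⟩
  have hI0 : I ≠ ⊥ := by
    have : z ∈ I := (hmem z).2 (Ideal.mem_span_singleton_mul.2 ⟨x, hxm, mul_comm _ _⟩)
    intro h
    exact hz0 (by simpa [h] using this)
  obtain ⟨y, hy | hy⟩ := hup I hI0
  · exfalso
    rw [hy, Ideal.span_singleton_mul_span_singleton] at hI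
    obtain ⟨c, hc⟩ := Ideal.eq_span_singleton_of_span_singleton_mul_eq hz0 hI.symm
    exact hnp c hc
  · refine ⟨y, ?_⟩
    rw [← hI, hy, ← mul_assoc, Ideal.span_singleton_mul_span_singleton]

/-- For w = z/x, write z𝔪 = xy𝔪. If y ∈ 𝔪, then z ∈ y𝔪 ⊆ x𝔪 and w ∈ 𝔪. If y is a unit, then z𝔪 = x𝔪,
so x² ∈ z𝔪 and w⁻¹ = x/z ∈ S. Thus the elements of S outside 𝔪 are units of S. -/
lemma inv_mem_divOverring (hup : PrincipalUpTo (maximalIdeal R))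
    (hnp : ∀ y, maximalIdeal R ≠ Ideal.span {y}) {w : K} (hw : w ∈ divOverring K hxm hx0 hmm)
    (hwm : ¬ ∃ t ∈ maximalIdeal R, w = algebraMap R K t) :
    w⁻¹ ∈ divOverring K hxm hx0 hmm := by
  have hx' : algebraMap R K x ≠ 0 := (map_ne_zero_iff _ (IsFractionRing.injective R K)).2 hx0
  have hw0 : w ≠ 0 := by
    rintro rfl
    exact hwm ⟨0, zero_mem _, by simp⟩
  obtain ⟨z, hz, hwz⟩ := mem_divOverring.1 hw
  have hz0 : z ≠ 0 := by
    rintro rfl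
    simp [hx', hw0] at hwz
  obtain ⟨y, hy⟩ := exists_span_singleton_mul_maximalIdeal_eq hxm hmm hup hnp hz hz0
  by_cases hym : y ∈ maximalIdeal R
  · exfalso
    have : z * x ∈ Ideal.span {x * y} * maximalIdeal R :=
      hy ▸ Ideal.mem_span_singleton_mul.2 ⟨x, hxm, rfl⟩
    obtain ⟨t, ht, hzt⟩ := Ideal.mem_span_singleton_mul.1 this
    have hyt : y * t ∈ Ideal.span {x} * maximalIdeal R := hmm ▸ Ideal.mul_mem_mul hym ht
    obtain ⟨s, hs, hst⟩ := Ideal.mem_span_singleton_mul.1 hyt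
    refine hwm ⟨s, hs, mul_left_cancel₀ hx' ?_⟩
    rw [hwz, ← map_mul, hst]
    congr 1
    exact mul_left_cancel₀ hx0 (by linear_combination -hzt)
  · have hyu : IsUnit y := by simpa using hym
    rw [← Ideal.span_singleton_mul_span_singleton, Ideal.span_singleton_eq_top.2 hyu,
      Ideal.mul_top] at hy
    have : x * x ∈ Ideal.span {z} * maximalIdeal R :=
      hy ▸ Ideal.mem_span_singleton_mul.2 ⟨x, hxm, rfl⟩
    obtain ⟨t, ht, hzt⟩ := Ideal.mem_span_singleton_mul.1 this
    refine mem_divOverring.2 ⟨t, ht, ?_⟩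
    rw [mul_inv_eq_iff_eq_mul₀ hw0]
    apply mul_left_cancel₀ hx'
    rw [← map_mul, ← hzt, map_mul, ← hwz]
    ring

/-- For e = c/d, the ideal J = (c, d)𝔪 satisfies J𝔪 = xJ, so it is not principal and J = y𝔪. This
writes e as a quotient of γ/x and δ/x in S. They are not both in 𝔪, since then J ⊆ yx𝔪. As e ∉ S,
δ/x is not a unit of S, so it lies in 𝔪; hence γ/x is a unit and e⁻¹ ∈ 𝔪S = 𝔪. -/
lemma inv_mem_maximalIdeal_of_notMem (hup : PrincipalUpTo (maximalIdeal R))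
    (hnp : ∀ y, maximalIdeal R ≠ Ideal.span {y}) {e : K} (he : e ∉ divOverring K hxm hx0 hmm) :
    ∃ t ∈ maximalIdeal R, e⁻¹ = algebraMap R K t := by
  have hinj := IsFractionRing.injective R K
  have hx' : algebraMap R K x ≠ 0 := (map_ne_zero_iff _ hinj).2 hx0
  obtain ⟨c, d, hd, rfl⟩ := IsFractionRing.div_surjective (A := R) e
  have hd0 : d ≠ 0 := nonZeroDivisors.ne_zero hd
  have hm0 : maximalIdeal R ≠ ⊥ := fun h => hnp 0 (by rw [h]; simp)
  let J : Ideal R := Ideal.span {c, d} * maximalIdeal R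
  have hJ0 : J ≠ ⊥ := by
    intro h
    rcases mul_eq_zero.1 (show Ideal.span {c, d} * maximalIdeal R = 0 from h) with h | h
    · have : d ∈ Ideal.span {c, d} := Ideal.subset_span (by simp)
      rw [h] at this
      exact hd0 (by simpa using this)
    · exact hm0 h
  have hJm : J * maximalIdeal R = Ideal.span {x} * J := by
    simp only [J]
    rw [mul_assoc, hmm]
    ring
  obtain ⟨y, hy | hy⟩ := hup J hJ0
  · exfalso
    have hy0 : y ≠ 0 := by rintro rfl; exact hJ0 (by rw [hy]; simp)
    rw [hy, Ideal.span_singleton_mul_span_singleton] at hJm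
    obtain ⟨c, hc⟩ := Ideal.eq_span_singleton_of_span_singleton_mul_eq hy0 hJm
    exact hnp c hc
  have hy0 : y ≠ 0 := by rintro rfl; exact hJ0 (by rw [hy]; simp)
  have hy' : algebraMap R K y ≠ 0 := (map_ne_zero_iff _ hinj).2 hy0
  have hc : c * x ∈ Ideal.span {y} * maximalIdeal R :=
    hy ▸ Ideal.mul_mem_mul (Ideal.subset_span (by simp)) hxm
  have hd : d * x ∈ Ideal.span {y} * maximalIdeal R :=
    hy ▸ Ideal.mul_mem_mul (Ideal.subset_span (by simp)) hxm
  obtain ⟨γ, hγm, hγ⟩ := Ideal.mem_span_singleton_mul.1 hc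
  obtain ⟨δ, hδm, hδ⟩ := Ideal.mem_span_singleton_mul.1 hd
  have hx_mul : ∀ k : K, algebraMap R K x * (k / algebraMap R K x) = k := fun k =>
    mul_div_cancel₀ k hx'
  have hγS : algebraMap R K γ / algebraMap R K x ∈ divOverring K hxm hx0 hmm :=
    mem_divOverring.2 ⟨γ, hγm, hx_mul _⟩
  have hδS : algebraMap R K δ / algebraMap R K x ∈ divOverring K hxm hx0 hmm :=
    mem_divOverring.2 ⟨δ, hδm, hx_mul _⟩
  have hδ0 : δ ≠ 0 := by
    rintro rfl
    exact mul_ne_zero hd0 hx0 (by rw [← hδ, mul_zero])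
  have hδ' : algebraMap R K δ ≠ 0 := (map_ne_zero_iff _ hinj).2 hδ0
  have hd' : algebraMap R K d ≠ 0 := (map_ne_zero_iff _ hinj).2 hd0
  have he_eq : algebraMap R K c / algebraMap R K d = algebraMap R K γ / algebraMap R K δ := by
    rw [div_eq_div_iff hd' hδ', ← map_mul, ← map_mul]
    congr 1
    apply mul_left_cancel₀ (mul_ne_zero hy0 hx0)
    linear_combination c * x * hδ - d * x * hγ
  by_cases hδt : ∃ t ∈ maximalIdeal R, algebraMap R K δ / algebraMap R K x = algebraMap R K t
  · obtain ⟨t, ht, hδt⟩ := hδt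
    by_cases hγt : ∃ t ∈ maximalIdeal R, algebraMap R K γ / algebraMap R K x = algebraMap R K t
    · exfalso
      obtain ⟨s, hs, hγs⟩ := hγt
      have h1 : γ = x * s := hinj (by rw [map_mul, ← hγs, hx_mul])
      have h2 : δ = x * t := hinj (by rw [map_mul, ← hδt, hx_mul])
      have hcs : c = y * s := mul_right_cancel₀ hx0 (by rw [← hγ, h1]; ring)
      have hdt : d = y * t := mul_right_cancel₀ hx0 (by rw [← hδ, h2]; ring)
      have hle : J ≤ Ideal.span {y} * (Ideal.span {x} * maximalIdeal R) := by
        rw [← hmm, ← mul_assoc]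
        refine Ideal.mul_mono_left (Ideal.span_le.2 ?_)
        rintro r (rfl | rfl)
        · exact Ideal.mem_span_singleton_mul.2 ⟨s, hs, hcs.symm⟩
        · exact Ideal.mem_span_singleton_mul.2 ⟨t, ht, hdt.symm⟩
      rw [hy] at hle
      have hxx : x ∈ Ideal.span {x} * maximalIdeal R :=
        (Ideal.span_singleton_mul_right_mono hy0).1 hle hxm
      obtain ⟨u, hu, hxu⟩ := Ideal.mem_span_singleton_mul.1 hxx
      have : u = 1 := mul_left_cancel₀ hx0 (by rw [hxu, mul_one])
      exact (mem_maximalIdeal _).1 hu (this ▸ isUnit_one)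
    · obtain ⟨v, hv, htv⟩ := exists_algebraMap_eq_mul ht (inv_mem_divOverring hup hnp hγS hγt)
      refine ⟨v, hv, ?_⟩
      rw [← htv, he_eq, ← hδt, inv_div, inv_div, div_mul_div_cancel₀ hx']
  · exfalso
    refine he ?_
    have := mul_mem hγS (inv_mem_divOverring hup hnp hδS hδt)
    rwa [inv_div, div_mul_div_cancel₀ hx', ← he_eq] at this

lemma eq_top_of_notMem_divOverring (hup : PrincipalUpTo (maximalIdeal R))
    (hnp : ∀ y, maximalIdeal R ≠ Ideal.span {y}) {E : Subalgebra R K} {e : K} (heE : e ∈ E)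
    (he : e ∉ divOverring K hxm hx0 hmm) : E = ⊤ := by
  have hinj := IsFractionRing.injective R K
  have he0 : e ≠ 0 := by rintro rfl; exact he (zero_mem _)
  obtain ⟨q, hq, hqe⟩ := inv_mem_maximalIdeal_of_notMem hup hnp he
  have hq' : algebraMap R K q ≠ 0 := hqe ▸ inv_ne_zero he0
  have hq0 : q ≠ 0 := (map_ne_zero_iff _ hinj).1 hq'
  have he_eq : e = (algebraMap R K q)⁻¹ := by rw [← hqe, inv_inv]
  rw [eq_top_iff]
  rintro k -
  obtain ⟨c, d, hd, rfl⟩ := IsFractionRing.div_surjective (A := R) k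
  have hd0 : d ≠ 0 := nonZeroDivisors.ne_zero hd
  have hd' : algebraMap R K d ≠ 0 := (map_ne_zero_iff _ hinj).2 hd0
  obtain ⟨n, hn⟩ := hup.exists_not_pow_dvd (maximalIdeal.isMaximal R).ne_top hq hq0 hd0
  -- The extra factor of q is spent on qS ⊆ 𝔪: membership in S would give qⁿ ∣ d. So the inverse t
  -- of this quotient lies in R, and 1/d = t·eⁿ⁺¹ ∈ E.
  by_cases h : algebraMap R K d / algebraMap R K q ^ (n + 1) ∈ divOverring K hxm hx0 hmm
  · exfalso
    obtain ⟨t, -, ht⟩ := exists_algebraMap_eq_mul hq h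
    refine hn ⟨t, hinj ?_⟩
    rw [map_mul, ← ht, map_pow]
    field_simp
    ring
  · obtain ⟨t, -, ht⟩ := inv_mem_maximalIdeal_of_notMem hup hnp h
    have : algebraMap R K c / algebraMap R K d =
        algebraMap R K c * (algebraMap R K t * e ^ (n + 1)) := by
      rw [← ht, he_eq, inv_div, inv_pow]
      field_simp
    rw [this]
    exact mul_mem (E.algebraMap_mem c) (mul_mem (E.algebraMap_mem t) (pow_mem heE _))

lemma eq_bot_or_eq_divOverring_or_eq_top (hup : PrincipalUpTo (maximalIdeal R))
    (hnp : ∀ y, maximalIdeal R ≠ Ideal.span {y}) {a b : R}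
    (hab : maximalIdeal R = Ideal.span {a, b}) (E : Subalgebra R K) :
    E = ⊥ ∨ E = divOverring K hxm hx0 hmm ∨ E = ⊤ := by
  by_cases hES : E ≤ divOverring K hxm hx0 hmm
  · by_cases hE : E ≤ ⊥
    · exact Or.inl (le_bot_iff.1 hE)
    obtain ⟨e, heE, heR⟩ := SetLike.not_le_iff_exists.1 hE
    refine Or.inr (Or.inl (le_antisymm hES ?_))
    have hx := hxm
    rw [hab] at hx
    obtain ⟨r₁, r₂, hr⟩ := Ideal.mem_span_pair.1 hx
    by_cases h₁ : IsUnit r₁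
    · exact divOverring_le_of_isUnit hab h₁ hr heE (hES heE) heR
    by_cases h₂ : IsUnit r₂
    · rw [add_comm] at hr
      rw [Set.pair_comm] at hab
      exact divOverring_le_of_isUnit hab h₂ hr heE (hES heE) heR
    -- With both coefficients in 𝔪, x would lie in 𝔪² = x𝔪.
    exfalso
    have hxx : x ∈ Ideal.span {x} * maximalIdeal R := by
      rw [← hmm]
      nth_rw 1 [← hr]
      refine add_mem (Ideal.mul_mem_mul h₁ ?_) (Ideal.mul_mem_mul h₂ ?_) <;> rw [hab] <;>
        exact Ideal.subset_span (by simp)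
    obtain ⟨u, hu, hxu⟩ := Ideal.mem_span_singleton_mul.1 hxx
    have : u = 1 := mul_left_cancel₀ hx0 (by rw [hxu, mul_one])
    exact (mem_maximalIdeal _).1 hu (this ▸ isUnit_one)
  · obtain ⟨e, heE, he⟩ := SetLike.not_le_iff_exists.1 hES
    exact Or.inr (Or.inr (eq_top_of_notMem_divOverring hup hnp heE he))

lemma mem_divOverring_or_inv_mem (hup : PrincipalUpTo (maximalIdeal R))
    (hnp : ∀ y, maximalIdeal R ≠ Ideal.span {y}) (k : K) :
    k ∈ divOverring K hxm hx0 hmm ∨ k⁻¹ ∈ divOverring K hxm hx0 hmm := by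
  by_cases h : k ∈ divOverring K hxm hx0 hmm
  · exact Or.inl h
  · obtain ⟨t, -, ht⟩ := inv_mem_maximalIdeal_of_notMem hup hnp h
    exact Or.inr (ht ▸ Subalgebra.algebraMap_mem _ t)

end NonBezout

/-! ### Counting the overrings of a local ring -/

section LocalCount

open IsLocalRing

lemma Subalgebra.bot_ne_top_of_not_isField {R K : Type*} [CommRing R] [Field K] [Algebra R K]
    [FaithfulSMul R K] (hR : ¬ IsField R) : (⊥ : Subalgebra R K) ≠ ⊤ := by
  intro h
  refine hR ?_
  have hbij : Function.Bijective (algebraMap R K) :=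
    ⟨FaithfulSMul.algebraMap_injective R K, fun k =>
      Algebra.mem_bot.1 (h ▸ Algebra.mem_top : k ∈ (⊥ : Subalgebra R K))⟩
  exact (RingEquiv.ofBijective _ hbij).toMulEquiv.isField (Field.toIsField K)

variable {R K : Type*} [CommRing R] [IsDomain R] [IsLocalRing R] [Field K] [Algebra R K]
  [IsFractionRing R K]

lemma PrincipalUpTo.card_subalgebra (hR : ¬ IsField R) {Q : Ideal R} [Q.IsPrime]
    (hup : PrincipalUpTo Q) :
    (Nat.card (Subalgebra R K) = 2 ∨ Nat.card (Subalgebra R K) = 3) ∧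
      ∀ E : Subalgebra R K, IsLocalRing E := by
  classical
  have : FaithfulSMul R K := (faithfulSMul_iff_algebraMap_injective R K).2
    (IsFractionRing.injective R K)
  have : Nontrivial (Subalgebra R K) := ⟨⟨_, _, Subalgebra.bot_ne_top_of_not_isField hR⟩⟩
  suffices h : (Finite (Subalgebra R K) ∧ Nat.card (Subalgebra R K) ≤ 3) ∧
      ∀ E : Subalgebra R K, IsLocalRing E by
    obtain ⟨⟨hfin, h3⟩, hloc⟩ := h
    have := Finite.one_lt_card (α := Subalgebra R K)
    exact ⟨by omega, hloc⟩
  by_cases hB : IsBezout R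
  · have : ValuationRing R := ValuationRing.iff_local_bezout_domain.2 ⟨inferInstance, hB⟩
    obtain ⟨hfin, hle⟩ := ValuationRing.card_subalgebra_le (K := K) hup
    refine ⟨⟨hfin, hle.trans Finset.card_le_three⟩, fun E => ?_⟩
    refine isLocalRing_of_mem_or_inv_mem E fun k => ?_
    rcases ValuationRing.isInteger_or_isInteger R k with ⟨r, hr⟩ | ⟨r, hr⟩
    · exact Or.inl (hr ▸ E.algebraMap_mem r)
    · exact Or.inr (hr ▸ E.algebraMap_mem r)
  · obtain ⟨a, b, hab, hnp⟩ := exists_eq_span_pair_of_not_isBezout hup hB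
    have hfg : Q.FG := ⟨{a, b}, by simp [hab]⟩
    obtain rfl := eq_maximalIdeal_of_fg hup hfg hnp
    obtain ⟨x, hxm, hx0, hmm⟩ := exists_maximalIdeal_mul_self_eq hup hfg hnp
    have key := eq_bot_or_eq_divOverring_or_eq_top (K := K) (hxm := hxm) (hx0 := hx0)
      (hmm := hmm) hup hnp hab
    let f : Subalgebra R K →
        ({⊥, divOverring K hxm hx0 hmm, ⊤} : Finset (Subalgebra R K)) := fun E =>
      ⟨E, by simpa only [Finset.mem_insert, Finset.mem_singleton] using key E⟩
    have hf : Function.Injective f := fun E F h => Subtype.ext_iff.1 h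
    refine ⟨⟨Finite.of_injective f hf, ((Nat.card_le_card_of_injective f hf).trans_eq
      (Nat.card_eq_finsetCard _)).trans Finset.card_le_three⟩, fun E => ?_⟩
    rcases key E with rfl | rfl | rfl
    · exact RingEquiv.isLocalRing
        (Algebra.botEquivOfInjective (IsFractionRing.injective R K)).symm.toRingEquiv
    · exact isLocalRing_of_mem_or_inv_mem _ (mem_divOverring_or_inv_mem hup hnp)
    · exact isLocalRing_of_mem_or_inv_mem _ fun k => Or.inl Algebra.mem_top

lemma PrincipalUpTo.card_subalgebra_eq_two (hR : ¬ IsField R)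
    (hup : PrincipalUpTo (⊥ : Ideal R)) : Nat.card (Subalgebra R K) = 2 := by
  classical
  have : FaithfulSMul R K := (faithfulSMul_iff_algebraMap_injective R K).2
    (IsFractionRing.injective R K)
  have : Nontrivial (Subalgebra R K) := ⟨⟨_, _, Subalgebra.bot_ne_top_of_not_isField hR⟩⟩
  have hB : IsBezout R := by
    refine ⟨fun I _ => ?_⟩
    by_cases hI : I = ⊥
    · exact hI ▸ bot_isPrincipal
    · obtain ⟨y, hy | hy⟩ := hup I hI
      · exact ⟨y, hy⟩
      · exact absurd (by rw [hy, Ideal.mul_bot]) hI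
  have : ValuationRing R := ValuationRing.iff_local_bezout_domain.2 ⟨inferInstance, hB⟩
  obtain ⟨hfin, hle⟩ := ValuationRing.card_subalgebra_le (K := K) hup
  have h2 : ({⊥, maximalIdeal R, ⊥} : Finset (Ideal R)).card ≤ 2 := by
    rw [Finset.insert_eq_of_mem (Finset.mem_insert_of_mem (Finset.mem_singleton_self _))]
    exact Finset.card_le_two
  have := Finite.one_lt_card (α := Subalgebra R K)
  omega

lemma PrincipalUpTo.bot_of_top {R : Type*} [CommRing R] (hup : PrincipalUpTo (⊤ : Ideal R)) :
    PrincipalUpTo (⊥ : Ideal R) := fun I hI => by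
  obtain ⟨x, hx⟩ := hup I hI
  exact ⟨x, Or.inl (by simpa using hx)⟩

lemma PrincipalUpTo.map {D : Type*} [CommRing D] {Q : Ideal D} (hup : PrincipalUpTo Q)
    (S : Submonoid D) (A : Type*) [CommRing A] [Algebra D A] [IsLocalization S A] :
    PrincipalUpTo (Q.map (algebraMap D A)) := by
  intro I hI
  have hcomap := IsLocalization.map_under S A I
  have h0 : I.under D ≠ ⊥ := by
    intro h
    rw [h, Ideal.map_bot] at hcomap
    exact hI hcomap.symm
  obtain ⟨x, hx | hx⟩ := hup _ h0
  · refine ⟨algebraMap D A x, Or.inl ?_⟩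
    rw [← hcomap, hx, Ideal.map_span, Set.image_singleton]
  · refine ⟨algebraMap D A x, Or.inr ?_⟩
    rw [← hcomap, hx, Ideal.map_mul, Ideal.map_span, Set.image_singleton]

end LocalCount

/-! ### Localizations of overrings inside K -/

section Localization

variable {D K : Type*} [CommRing D] [Field K] [Algebra D K]

/-- The localization at a prime `P` of an overring of `D`, inside the field `K`. -/
def Subalgebra.locAt (E : Subalgebra D K) (P : Ideal D) [P.IsPrime] : Subalgebra D K where
  carrier := {k | ∃ s ∉ P, s • k ∈ E}
  add_mem' := by
    rintro k l ⟨s, hs, hk⟩ ⟨t, ht, hl⟩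
    refine ⟨s * t, fun h => (Ideal.IsPrime.mem_or_mem ‹_› h).elim hs ht, ?_⟩
    rw [smul_add]
    refine add_mem ?_ ?_
    · rw [mul_comm, mul_smul]; exact E.smul_mem hk t
    · rw [mul_smul]; exact E.smul_mem hl s
  mul_mem' := by
    rintro k l ⟨s, hs, hk⟩ ⟨t, ht, hl⟩
    refine ⟨s * t, fun h => (Ideal.IsPrime.mem_or_mem ‹_› h).elim hs ht, ?_⟩
    rw [← smul_mul_smul_comm]
    exact mul_mem hk hl
  algebraMap_mem' r :=
    ⟨1, (Ideal.ne_top_iff_one _).1 (Ideal.IsPrime.ne_top ‹_›), by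
      rw [one_smul]; exact E.algebraMap_mem r⟩

namespace Subalgebra

lemma mem_locAt {E : Subalgebra D K} {P : Ideal D} [P.IsPrime] {k : K} :
    k ∈ E.locAt P ↔ ∃ s ∉ P, s • k ∈ E := Iff.rfl

lemma le_locAt (E : Subalgebra D K) (P : Ideal D) [hP : P.IsPrime] : E ≤ E.locAt P :=
  fun k hk => ⟨1, (Ideal.ne_top_iff_one _).1 hP.ne_top, by rwa [one_smul]⟩

lemma locAt_mono {E F : Subalgebra D K} (h : E ≤ F) (P : Ideal D) [P.IsPrime] :
    E.locAt P ≤ F.locAt P := fun _ ⟨s, hs, hk⟩ => ⟨s, hs, h hk⟩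

lemma iInf_locAt (E : Subalgebra D K) :
    ⨅ M : MaximalSpectrum D, E.locAt M.asIdeal = E := by
  refine le_antisymm (fun k hk => ?_) (le_iInf fun M => E.le_locAt _)
  -- The denominators of k relative to E form an ideal contained in no maximal ideal.
  let I : Ideal D := Submodule.comap (LinearMap.toSpanSingleton D K k) (Subalgebra.toSubmodule E)
  have hI : ∀ d, d ∈ I ↔ d • k ∈ E := fun d => Iff.rfl
  have : I = ⊤ := by
    by_contra hne
    obtain ⟨M, hM, hIM⟩ := I.exists_le_maximal hne
    obtain ⟨s, hs, hsk⟩ := mem_locAt.1 ((Algebra.mem_iInf.1 hk) ⟨M, hM⟩)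
    exact hs (hIM ((hI s).2 hsk))
  have h1 : (1 : D) ∈ I := this ▸ Submodule.mem_top
  simpa using (hI 1).1 h1

/-- Take M above the contraction of the maximal ideal of E: elements of D outside M are units in E.
-/
lemma exists_bot_locAt_le (E : Subalgebra D K) (hE : IsLocalRing E) :
    ∃ M : MaximalSpectrum D, (⊥ : Subalgebra D K).locAt M.asIdeal ≤ E := by
  have hP : ((IsLocalRing.maximalIdeal E).comap (algebraMap D E)).IsPrime := inferInstance
  obtain ⟨M, hM, hPM⟩ := Ideal.exists_le_maximal _ hP.ne_top
  refine ⟨⟨M, hM⟩, ?_⟩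
  rintro k ⟨s, hs, hk⟩
  have hu : IsUnit (algebraMap D E s) := by
    by_contra h
    exact hs (hPM h)
  obtain ⟨u, hu⟩ := hu.exists_left_inv
  have hu' : (u : K) * algebraMap D K s = 1 := congrArg Subtype.val hu
  have : k = u * (s • k) := by rw [Algebra.smul_def, ← mul_assoc, hu', one_mul]
  rw [this]
  exact mul_mem u.2 (bot_le (a := E) hk)

variable [IsFractionRing D K]

variable (K) in
lemma algebraMap_ne_zero_of_notMem {P : Ideal D} {s : D} (hs : s ∉ P) : algebraMap D K s ≠ 0 :=
  (map_ne_zero_iff _ (IsFractionRing.injective D K)).2 fun h => hs (h ▸ P.zero_mem)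

lemma inv_mem_bot_locAt {P : Ideal D} [P.IsPrime] {s : D} (hs : s ∉ P) :
    (algebraMap D K s)⁻¹ ∈ (⊥ : Subalgebra D K).locAt P :=
  ⟨s, hs, by
    rw [Algebra.smul_def, mul_inv_cancel₀ (algebraMap_ne_zero_of_notMem K hs)]
    exact one_mem _⟩

lemma locAt_eq_self {E : Subalgebra D K} {P : Ideal D} [P.IsPrime]
    (h : (⊥ : Subalgebra D K).locAt P ≤ E) : E.locAt P = E := by
  refine le_antisymm ?_ (E.le_locAt P)
  rintro k ⟨s, hs, hk⟩
  have : k = (algebraMap D K s)⁻¹ * (s • k) := by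
    rw [Algebra.smul_def, inv_mul_cancel_left₀ (algebraMap_ne_zero_of_notMem K hs)]
  rw [this]
  exact mul_mem (h (inv_mem_bot_locAt hs)) hk

lemma le_of_bot_locAt_le {M N : Ideal D} [hM : M.IsPrime] [N.IsPrime]
    (h : (⊥ : Subalgebra D K).locAt N ≤ (⊥ : Subalgebra D K).locAt M) : M ≤ N := by
  intro s hs
  by_contra hsN
  obtain ⟨t, ht, hts⟩ := h (inv_mem_bot_locAt hsN)
  obtain ⟨d, hd⟩ := Algebra.mem_bot.1 hts
  refine ht ?_
  have : t = d * s := by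
    apply IsFractionRing.injective D K
    rw [map_mul, hd, Algebra.smul_def, inv_mul_cancel_right₀ (algebraMap_ne_zero_of_notMem K hsN)]
  exact this ▸ M.mul_mem_left d hs

instance isLocalization_bot_locAt (P : Ideal D) [P.IsPrime] :
    IsLocalization.AtPrime ((⊥ : Subalgebra D K).locAt P) P where
  map_units s := by
    refine IsUnit.of_mul_eq_one ⟨_, inv_mem_bot_locAt s.2⟩ (Subtype.ext ?_)
    exact mul_inv_cancel₀ (algebraMap_ne_zero_of_notMem K s.2)
  surj := by
    rintro ⟨k, s, hs, hk⟩
    obtain ⟨d, hd⟩ := Algebra.mem_bot.1 hk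
    refine ⟨(d, ⟨s, hs⟩), Subtype.ext ?_⟩
    change k * algebraMap D K s = algebraMap D K d
    rw [hd, Algebra.smul_def, mul_comm]
  exists_of_eq := by
    intro x y h
    refine ⟨1, ?_⟩
    have : algebraMap D K x = algebraMap D K y := congrArg Subtype.val h
    rw [IsFractionRing.injective D K this]

instance isFractionRing_of_subalgebra [IsDomain D] (E : Subalgebra D K) : IsFractionRing E K where
  map_units s := by
    refine IsUnit.mk0 _ ?_
    simp [nonZeroDivisors.ne_zero s.2]
  surj k := by
    obtain ⟨c, d, hd, rfl⟩ := IsFractionRing.div_surjective (A := D) k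
    have hd' : algebraMap D K d ≠ 0 :=
      (map_ne_zero_iff _ (IsFractionRing.injective D K)).2 (nonZeroDivisors.ne_zero hd)
    refine ⟨(algebraMap D E c, ⟨algebraMap D E d, mem_nonZeroDivisors_of_ne_zero ?_⟩), ?_⟩
    · intro h
      exact hd' (congrArg Subtype.val h)
    · change algebraMap D K c / algebraMap D K d * algebraMap D K d = algebraMap D K c
      rw [div_mul_cancel₀ _ hd']
  exists_of_eq {x y} h := ⟨1, by rw [Subtype.ext h]⟩

/-- Overrings of `D` containing `L` are the `L`-subalgebras of `K`. -/
def equivSubalgebra (L : Subalgebra D K) : Subalgebra L K ≃ {E : Subalgebra D K // L ≤ E} where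
  toFun E := ⟨E.restrictScalars D, fun k hk => E.algebraMap_mem ⟨k, hk⟩⟩
  invFun E := { E.1 with algebraMap_mem' := fun r => E.2 r.2 }
  left_inv _ := rfl
  right_inv _ := rfl

end Subalgebra

end Localization

/-! ### Gluing local counts into global ones -/

section Count

variable {D K : Type*} [CommRing D] [Field K] [Algebra D K] [IsFractionRing D K]

namespace Subalgebra

lemma iInf_locAt_eq [Finite (MaximalSpectrum D)]
    (hsup : ∀ M N : MaximalSpectrum D, M ≠ N →
      ((⊥ : Subalgebra D K).locAt M.asIdeal).locAt N.asIdeal = ⊤)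
    (F : ∀ M : MaximalSpectrum D, {E : Subalgebra D K // (⊥ : Subalgebra D K).locAt M.asIdeal ≤ E})
    (N : MaximalSpectrum D) : (⨅ M, (F M).1).locAt N.asIdeal = (F N).1 := by
  classical
  have := Fintype.ofFinite (MaximalSpectrum D)
  refine le_antisymm ?_ fun k hk => ?_
  · exact (locAt_mono (iInf_le _ N) _).trans_eq (locAt_eq_self (F N).2)
  have h : ∀ M, ∃ s ∉ N.asIdeal, s • k ∈ (F M).1 := by
    intro M
    by_cases hMN : M = N
    · subst hMN
      exact (F M).1.le_locAt _ hk
    · have : (F M).1.locAt N.asIdeal = ⊤ :=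
        top_le_iff.1 ((hsup M N hMN).ge.trans (locAt_mono (F M).2 _))
      exact (this ▸ Algebra.mem_top : k ∈ (F M).1.locAt N.asIdeal)
  choose s hs hsk using h
  -- Finiteness of the maximal spectrum lets one product serve as denominator for every component.
  refine ⟨∏ M, s M, fun h => ?_, Algebra.mem_iInf.2 fun M => ?_⟩
  · obtain ⟨M, -, hM⟩ := (Ideal.IsPrime.prod_mem_iff).1 h
    exact hs M hM
  · rw [← Finset.prod_erase_mul _ _ (Finset.mem_univ M), mul_smul]
    exact (F M).1.smul_mem (hsk M) _

/-- When the localizations at distinct maximal ideals generate `K`, an overring of a semilocal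
ring amounts to a family of overrings of these localizations. -/
def equivPi [Finite (MaximalSpectrum D)]
    (hsup : ∀ M N : MaximalSpectrum D, M ≠ N →
      ((⊥ : Subalgebra D K).locAt M.asIdeal).locAt N.asIdeal = ⊤) :
    Subalgebra D K ≃
      ∀ M : MaximalSpectrum D, {E : Subalgebra D K // (⊥ : Subalgebra D K).locAt M.asIdeal ≤ E} where
  toFun E M := ⟨E.locAt M.asIdeal, locAt_mono bot_le _⟩
  invFun F := ⨅ M, (F M).1
  left_inv E := iInf_locAt E
  right_inv F := funext fun N => Subtype.ext (iInf_locAt_eq hsup F N)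

/-- The overring attached to a proper overring of a localization, or `K` itself. -/
def quasiLocalOfOption
    (hloc : ∀ (M : MaximalSpectrum D) (E : Subalgebra D K),
      (⊥ : Subalgebra D K).locAt M.asIdeal ≤ E → IsLocalRing E)
    (htop : IsLocalRing (⊤ : Subalgebra D K)) :
    Option (Σ M : MaximalSpectrum D,
      {E : {E : Subalgebra D K // (⊥ : Subalgebra D K).locAt M.asIdeal ≤ E} //
        E ≠ ⟨⊤, le_top⟩}) → QuasiLocalOverring D K
  | none => ⟨⊤, htop⟩
  | some ⟨M, E⟩ => ⟨E.1.1, hloc M _ E.1.2⟩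

lemma quasiLocalOfOption_bijective
    (hsup : ∀ M N : MaximalSpectrum D, M ≠ N →
      ((⊥ : Subalgebra D K).locAt M.asIdeal).locAt N.asIdeal = ⊤)
    (hloc : ∀ (M : MaximalSpectrum D) (E : Subalgebra D K),
      (⊥ : Subalgebra D K).locAt M.asIdeal ≤ E → IsLocalRing E)
    (htop : IsLocalRing (⊤ : Subalgebra D K)) :
    Function.Bijective (quasiLocalOfOption hloc htop) := by
  constructor
  · rintro (_ | ⟨M, E, hE⟩) (_ | ⟨N, F, hF⟩) h
    · rfl
    · exact (hF (Subtype.ext (Subtype.ext_iff.1 h).symm)).elim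
    · exact (hE (Subtype.ext (show E.1 = ⊤ from congrArg Subtype.val h))).elim
    · have hEF : E.1 = F.1 := Subtype.ext_iff.1 h
      by_cases hMN : M = N
      · subst hMN
        obtain rfl : E = F := Subtype.ext hEF
        rfl
      · refine absurd (Subtype.ext (top_le_iff.1 ?_)) hE
        rw [← hsup M N hMN, ← locAt_eq_self (hEF ▸ F.2 : _ ≤ E.1)]
        exact locAt_mono E.2 _
  · rintro ⟨E, hE⟩
    by_cases hT : E = ⊤
    · exact ⟨none, Subtype.ext hT.symm⟩
    · obtain ⟨M, hM⟩ := exists_bot_locAt_le E hE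
      exact ⟨some ⟨M, ⟨E, hM⟩, fun h => hT (Subtype.ext_iff.1 h)⟩, rfl⟩

end Subalgebra

lemma Nat.card_ne_eq_sub_one {α : Type*} [Finite α] (a : α) :
    Nat.card {x // x ≠ a} = Nat.card α - 1 := by
  classical
  have := Fintype.ofFinite α
  simp [Nat.card_eq_fintype_card, Fintype.card_subtype_compl]

lemma prod_and_sum_of_eq_two {ι : Type*} [Fintype ι] {n : ℕ} (hn : Nat.card ι = n) (c : ι → ℕ)
    (i₀ : ι) (h₀ : c i₀ = 2 ∨ c i₀ = 3) (hc : ∀ i, i ≠ i₀ → c i = 2) :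
    (∏ i, c i = 2 ^ n ∨ ∏ i, c i = 3 * 2 ^ (n - 1)) ∧
      (∑ i, (c i - 1) + 1 = n + 2 ∨ ∑ i, (c i - 1) + 1 = n + 1) := by
  classical
  have hn' : Fintype.card ι = n := by rw [← hn, Nat.card_eq_fintype_card]
  have hpos : 0 < Fintype.card ι := Fintype.card_pos_iff.2 ⟨i₀⟩
  have hprod : ∏ i ∈ Finset.univ.erase i₀, c i = 2 ^ (n - 1) := by
    rw [Finset.prod_congr rfl fun i hi => hc i (Finset.ne_of_mem_erase hi), Finset.prod_const,
      Finset.card_erase_of_mem (Finset.mem_univ _), Finset.card_univ, hn']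
  have hsum : ∑ i ∈ Finset.univ.erase i₀, (c i - 1) = n - 1 := by
    rw [Finset.sum_congr rfl fun i hi => by rw [hc i (Finset.ne_of_mem_erase hi)],
      Finset.sum_const, Finset.card_erase_of_mem (Finset.mem_univ _), Finset.card_univ, hn']
    simp
  rw [← Finset.mul_prod_erase _ c (Finset.mem_univ i₀),
    ← Finset.add_sum_erase _ (fun i => c i - 1) (Finset.mem_univ i₀), hprod, hsum]
  rcases h₀ with h | h <;> rw [h]
  · refine ⟨Or.inl ?_, Or.inr (by omega)⟩
    rw [← pow_succ', Nat.sub_add_cancel (by omega)]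
  · exact ⟨Or.inr rfl, Or.inl (by omega)⟩

end Count

/-! ### The main count -/

section Main

variable {D K : Type*} [CommRing D] [IsDomain D] [Field K] [Algebra D K] [IsFractionRing D K]

lemma not_isField_bot_locAt (hfield : ¬ IsField D) (M : Ideal D) [hM : M.IsMaximal] :
    ¬ IsField ((⊥ : Subalgebra D K).locAt M) := by
  intro h
  refine Ring.ne_bot_of_isMaximal_of_not_isField hM hfield ((Submodule.eq_bot_iff _).2 ?_)
  intro s hs
  by_contra hs0
  have hs' : algebraMap D ((⊥ : Subalgebra D K).locAt M) s ≠ 0 := by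
    simpa using hs0
  have := (IsLocalization.AtPrime.isUnit_to_map_iff ((⊥ : Subalgebra D K).locAt M) M s).1
    (IsUnit.of_mul_eq_one _ (h.mul_inv_cancel hs').choose_spec)
  exact this hs

end Main

theorem theorem2p9 {D K : Type*} [CommRing D] [IsDomain D] [Field K] [Algebra D K]
    [IsFractionRing D K] (hfield : ¬ IsField D) (hD : IsMPDDomain D)
    (n : ℕ) [Finite (MaximalSpectrum D)] (hn : Nat.card (MaximalSpectrum D) = n) :
    (Nat.card (Overring D K) = 2 ^ n ∨ Nat.card (Overring D K) = 3 * 2 ^ (n - 1)) ∧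
    (Nat.card (QuasiLocalOverring D K) = n + 2 ∨
      Nat.card (QuasiLocalOverring D K) = n + 1) := by
  obtain ⟨Q, hQ, hup, hmax⟩ := hD.exists_prime
  have := Fintype.ofFinite (MaximalSpectrum D)
  let L : MaximalSpectrum D → Subalgebra D K := fun M => (⊥ : Subalgebra D K).locAt M.asIdeal
  have hlocal : ∀ M, IsLocalRing (L M) := fun M =>
    IsLocalization.AtPrime.isLocalRing (L M) M.asIdeal
  have hcong : ∀ M, Nat.card {E // L M ≤ E} = Nat.card (Subalgebra (L M) K) := fun M =>
    (Nat.card_congr (L M).equivSubalgebra).symm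
  have hupL : ∀ M, PrincipalUpTo (Q.map (algebraMap D (L M))) := fun M =>
    hup.map M.asIdeal.primeCompl (L M)
  have htwo : ∀ M, PrincipalUpTo (⊥ : Ideal (L M)) → Nat.card {E // L M ≤ E} = 2 := fun M h => by
    rw [hcong]
    exact h.card_subalgebra_eq_two (not_isField_bot_locAt hfield M.asIdeal)
  have hnotle : ∀ M : MaximalSpectrum D, ¬ Q ≤ M.asIdeal → PrincipalUpTo (⊥ : Ideal (L M)) := by
    intro M hM
    obtain ⟨s, hsQ, hsM⟩ := SetLike.not_le_iff_exists.1 hM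
    apply PrincipalUpTo.bot_of_top
    have : Q.map (algebraMap D (L M)) = ⊤ :=
      Ideal.eq_top_of_isUnit_mem _ (Ideal.mem_map_of_mem _ hsQ)
        (IsLocalization.map_units (L M) (⟨s, hsM⟩ : M.asIdeal.primeCompl))
    exact this ▸ hupL M
  have hbot : Q = ⊥ → ∀ M, PrincipalUpTo (⊥ : Ideal (L M)) := by
    rintro rfl M
    simpa using hupL M
  have hall : ∀ M, (Nat.card {E // L M ≤ E} = 2 ∨ Nat.card {E // L M ≤ E} = 3) ∧
      ∀ E, L M ≤ E → IsLocalRing E := by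
    intro M
    rw [hcong]
    -- The extension of Q is prime only when Q ≤ M; otherwise it is the unit ideal, and ⊥ takes its
    -- place.
    suffices h : ∃ P : Ideal (L M), P.IsPrime ∧ PrincipalUpTo P by
      obtain ⟨P, hP, hupP⟩ := h
      obtain ⟨hcard, hloc⟩ := hupP.card_subalgebra (K := K)
        (not_isField_bot_locAt hfield M.asIdeal)
      exact ⟨hcard, fun E hE => hloc ((L M).equivSubalgebra.symm ⟨E, hE⟩)⟩
    by_cases hM : Q ≤ M.asIdeal
    · exact ⟨_, IsLocalization.isPrime_of_isPrime_disjoint M.asIdeal.primeCompl (L M) Q hQ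
        (Set.disjoint_left.2 fun s hs hsQ => hs (hM hsQ)), hupL M⟩
    · exact ⟨⊥, Ideal.isPrime_bot, hnotle M hM⟩
  obtain ⟨M₀, hM₀⟩ : ∃ M₀, ∀ M, M ≠ M₀ → Nat.card {E // L M ≤ E} = 2 := by
    by_cases hQ0 : Q = ⊥
    · exact ⟨Classical.arbitrary _, fun M _ => htwo M (hbot hQ0 M)⟩
    · obtain ⟨M₀, hM₀, hQM₀⟩ := Q.exists_le_maximal hQ.ne_top
      refine ⟨⟨M₀, hM₀⟩, fun M hM => htwo M (hnotle M fun hQM => hM ?_)⟩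
      exact MaximalSpectrum.ext (maximal_eq_of_le_of_le hQ0 hup hmax M.isMaximal hM₀ hQM hQM₀)
  have hne : ∀ M, L M ≠ ⊤ := by
    intro M h
    refine not_isField_bot_locAt (K := K) hfield M.asIdeal ?_
    exact ((Subalgebra.equivOfEq _ _ h).trans Subalgebra.topEquiv).toMulEquiv.isField
      (Field.toIsField K)
  have hdich : ∀ M, M ≠ M₀ → ∀ E, L M ≤ E → E = L M ∨ E = ⊤ := by
    intro M hM E hE
    obtain ⟨y, -, hy⟩ := (Nat.card_eq_two_iff' (⟨L M, le_rfl⟩ : {E // L M ≤ E})).1 (hM₀ M hM)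
    by_contra! h
    have h1 := hy ⟨E, hE⟩ fun h' => h.1 (Subtype.ext_iff.1 h')
    have h2 := hy ⟨⊤, le_top⟩ fun h' => hne M (Subtype.ext_iff.1 h').symm
    exact h.2 (Subtype.ext_iff.1 (h1.trans h2.symm))
  have hincomp : ∀ M N : MaximalSpectrum D, M ≠ N → ¬ L N ≤ L M := fun M N hMN h =>
    hMN (MaximalSpectrum.ext
      (M.isMaximal.eq_of_le N.isMaximal.ne_top (Subalgebra.le_of_bot_locAt_le h)))
  -- At least one of M, N differs from `M₀`, and its localization has only K strictly above it. The
  -- compositum is therefore K, since the localizations are incomparable.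
  have hsup : ∀ M N : MaximalSpectrum D, M ≠ N → (L M).locAt N.asIdeal = ⊤ := by
    intro M N hMN
    have hM : L M ≤ (L M).locAt N.asIdeal := Subalgebra.le_locAt _ _
    have hN : L N ≤ (L M).locAt N.asIdeal := Subalgebra.locAt_mono bot_le _
    by_cases h : M = M₀
    · exact (hdich N (h ▸ hMN.symm) _ hN).resolve_left fun h' =>
        hincomp N M hMN.symm (hM.trans_eq h')
    · exact (hdich M h _ hM).resolve_left fun h' => hincomp M N hMN (hN.trans_eq h')
  have hfin : ∀ M, Finite {E // L M ≤ E} := fun M =>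
    Nat.finite_of_card_ne_zero (by have := (hall M).1; omega)
  have hcount := prod_and_sum_of_eq_two hn (fun M => Nat.card {E // L M ≤ E}) M₀ (hall M₀).1 hM₀
  have htop : IsLocalRing (⊤ : Subalgebra D K) := (hall M₀).2 ⊤ le_top
  have h1 : Nat.card (Overring D K) = ∏ M, Nat.card {E // L M ≤ E} := by
    rw [Nat.card_congr (Subalgebra.equivPi hsup), Nat.card_pi]
  have h2 : Nat.card (QuasiLocalOverring D K) = ∑ M, (Nat.card {E // L M ≤ E} - 1) + 1 := by
    rw [← Nat.card_congr (Equiv.ofBijective _ (Subalgebra.quasiLocalOfOption_bijective hsup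
      (fun M => (hall M).2) htop)), Finite.card_option, Nat.card_sigma]
    simp only [Nat.card_ne_eq_sub_one]
    rfl
  rw [h1, h2]
  exact hcount
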